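/- Let $G=(V,E)$ be a finite, unweighted, undirected graph (not necessarily connected) with shortest-path distance $d$, and let $\epsilon>1$ be a real number, the locality parameter. A pair of connected vertices $u,v$ is called local if $d(u,v)<\epsilon$ and non-local if $\epsilon\le d(u,v)<\infty$. A set $V^\ast\subseteq V$ is a gate-vertex set if for every non-local pair $u,v$ there is a sequence $u=v_0,v_1,\dots,v_k,v_{k+1}=v$ with $v_1,\dots,v_k\in V^\ast$ such that every consecutive pair $v_i,v_{i+1}$ is local and $\sum_{i=0}^{k} d(v_i,v_{i+1})=d(u,v)$. A minimum gate-vertex set is a gate-vertex set of smallest cardinality. Theorem. There is an absolute constant $C>0$ such that for every such $G$ and $\epsilon$ a minimum gate-vertex set exists, and its size is at most $$C\cdot\frac{|V|}{\epsilon-1}\,\log\max\Bigl(2,\frac{|V|}{\epsilon-1}\Bigr).$$ In particular, the size is at most $C\,\frac{|V|}{\epsilon-1}\log\frac{|V|}{\epsilon-1}$ whenever $|V|\ge 2(\epsilon-1)$; that is, it is $O\bigl(\frac{|V|}{\epsilon-1}\log\frac{|V|}{\epsilon-1}\bigr)$. -/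

import Mathlib

namespace GateVertex

/-- A local pair for the threshold `ε`: two connected vertices at distance less than `ε`.
(`G.dist` is `0` on disconnected pairs, so connectedness is required separately.) -/
def IsLocalPair {V : Type*} (G : SimpleGraph V) (ε : ℝ) (u v : V) : Prop :=
  G.Reachable u v ∧ (G.dist u v : ℝ) < ε

/-- A non-local pair for the threshold `ε`: two vertices at finite distance at least `ε`. -/
def IsNonlocalPair {V : Type*} (G : SimpleGraph V) (ε : ℝ) (u v : V) : Prop :=
  G.Reachable u v ∧ ε ≤ (G.dist u v : ℝ)

/-- `S` is a gate-vertex set of `G` for the threshold `ε`: every non-local pair `u, v` is joined by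
a sequence `u = w 0, w 1, …, w k, w (k + 1) = v` with `w 1, …, w k ∈ S`, whose consecutive pairs
are local and whose consecutive distances add up to the distance from `u` to `v`. -/
def IsGateVertexSet {V : Type*} (G : SimpleGraph V) (ε : ℝ) (S : Finset V) : Prop :=
  ∀ u v : V, IsNonlocalPair G ε u v →
    ∃ (k : ℕ) (w : ℕ → V), w 0 = u ∧ w (k + 1) = v ∧
      (∀ i, 1 ≤ i → i ≤ k → w i ∈ S) ∧
      (∀ i, i ≤ k → IsLocalPair G ε (w i) (w (i + 1))) ∧
      ∑ i ∈ Finset.range (k + 1), G.dist (w i) (w (i + 1)) = G.dist u v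

/-- A gate-vertex set of smallest cardinality. -/
def IsMinimumGateVertexSet {V : Type*} (G : SimpleGraph V) (ε : ℝ) (S : Finset V) : Prop :=
  IsGateVertexSet G ε S ∧ ∀ T : Finset V, IsGateVertexSet G ε T → S.card ≤ T.card

end GateVertex

/-! Put `n = |V|` and `m = ⌈ε⌉₊`. A connected pair is local exactly when its distance is below `m`,
so it suffices to hit the interior of every interval of length `m`; a geodesic is then cut at gates
recursively (`isGateVertexSet_of_forall_dist_eq_ceil`).

Take `a` about `m / 3`. In a shortest-path tree, consider the branches reaching depth `2a` and their
segments at depths `1, …, a`. Each segment owns `a` descendants, so a root has at most `n / a`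
segments (`exists_initial_segments`), and all roots together at most `n² / a`. Greedily choosing
about `2 (n / a) log (n / a)` vertices leaves fewer than `a` segments unhit. A missed interval would
leave `a` of them, one rooted at each of the first `a` vertices of a geodesic. Tolerating these
leftovers is what gives `log (n / a)` instead of `log n`. -/

namespace GateVertex

open Finset

/-! ### Geodesics and shortest-path trees -/

section Geodesics

variable {V : Type*} {G : SimpleGraph V}

/-- `s` lies on a shortest path from `u` to `v`. -/
def Between (G : SimpleGraph V) (u s v : V) : Prop :=
  G.Reachable u s ∧ G.Reachable s v ∧ G.dist u s + G.dist s v = G.dist u v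

/-- If `x` lies on a shortest path from `u` to `v` and `s` on one from `x` to `v`, then `s` lies on
one from `u` to `v`. -/
theorem Between.trans_right {u x s v : V} (hx : Between G u x v) (hs : Between G x s v) :
    Between G u s v ∧ G.dist x s ≤ G.dist u s := by
  obtain ⟨h1, h2, h3⟩ := hx
  obtain ⟨h4, h5, h6⟩ := hs
  have t1 := h1.dist_triangle_left s
  have t2 := h5.dist_triangle_right u
  have t3 := h1.symm.dist_triangle_left s
  refine ⟨⟨h1.trans h4, h5, by omega⟩, by omega⟩

/-- The parent function of a shortest-path tree rooted at `u`. -/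
theorem exists_parent (G : SimpleGraph V) (u : V) :
    ∃ f : V → V, ∀ x, G.Reachable u x → x ≠ u →
      G.Adj x (f x) ∧ G.dist u (f x) + 1 = G.dist u x := by
  have key : ∀ x, ∃ y, G.Reachable u x → x ≠ u → G.Adj x y ∧ G.dist u y + 1 = G.dist u x := by
    intro x
    by_cases h : G.Reachable u x ∧ x ≠ u
    · obtain ⟨hr, hne⟩ := h
      obtain ⟨p, hp⟩ := hr.symm.exists_walk_length_eq_dist
      cases p with
      | nil => exact absurd rfl hne
      | @cons _ y _ hadj q =>
        refine ⟨y, fun _ _ => ⟨hadj, ?_⟩⟩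
        have h1 := G.dist_le q
        have h2 := hadj.reachable.dist_triangle_left u
        rw [SimpleGraph.dist_eq_one_iff_adj.2 hadj] at h2
        rw [SimpleGraph.Walk.length_cons] at hp
        rw [SimpleGraph.dist_comm (u := u) (v := y), SimpleGraph.dist_comm (u := u) (v := x)]
        omega
    · exact ⟨x, fun h1 h2 => absurd ⟨h1, h2⟩ h⟩
  choose f hf using key
  exact ⟨f, hf⟩

/-- The iterated parents of `x` lie on a shortest path from the root to `x`. -/
theorem between_iterate_parent {u : V} {f : V → V}
    (hf : ∀ x, G.Reachable u x → x ≠ u → G.Adj x (f x) ∧ G.dist u (f x) + 1 = G.dist u x)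
    {x : V} (hx : G.Reachable u x) {k : ℕ} (hk : k ≤ G.dist u x) :
    Between G u (f^[k] x) x ∧ G.dist u (f^[k] x) = G.dist u x - k := by
  induction k with
  | zero => exact ⟨⟨hx, .refl _, by simp⟩, by simp⟩
  | succ k ih =>
    obtain ⟨⟨h1, h2, h3⟩, h4⟩ := ih (by omega)
    rw [Function.iterate_succ_apply']
    have hne : f^[k] x ≠ u := by
      intro h
      rw [h, SimpleGraph.dist_self] at h4
      omega
    obtain ⟨hadj, hd⟩ := hf _ h1 hne
    have hr := hadj.symm.reachable
    have t1 := hr.dist_triangle_left x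
    have t2 := (h1.trans hadj.reachable).dist_triangle_left x
    rw [SimpleGraph.dist_eq_one_iff_adj.2 hadj.symm] at t1
    exact ⟨⟨h1.trans hadj.reachable, hr.trans h2, by omega⟩, by omega⟩

/-- A shortest path contains a vertex at every intermediate distance. -/
theorem exists_between_dist_eq {u v : V} (h : G.Reachable u v) {i : ℕ} (hi : i ≤ G.dist u v) :
    ∃ x, Between G u x v ∧ G.dist u x = i := by
  obtain ⟨f, hf⟩ := exists_parent G u
  obtain ⟨h1, h2⟩ := between_iterate_parent hf h (Nat.sub_le (G.dist u v) i)
  exact ⟨_, h1, by omega⟩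

end Geodesics

/-- `S` is a gate-vertex set as soon as it meets the interior of every interval of length `⌈ε⌉`. -/
theorem isGateVertexSet_of_forall_dist_eq_ceil {V : Type*} {G : SimpleGraph V} {ε : ℝ}
    {S : Finset V}
    (hS : ∀ u v, G.Reachable u v → G.dist u v = ⌈ε⌉₊ →
      ∃ s ∈ S, Between G u s v ∧ 0 < G.dist u s ∧ G.dist u s < ⌈ε⌉₊) :
    IsGateVertexSet G ε S := by
  -- Non-locality is dropped so that the induction also covers the remainder from `s` to `v`, which
  -- may be local.
  suffices H : ∀ (N : ℕ) (u v : V), G.dist u v = N → G.Reachable u v →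
      ∃ (k : ℕ) (w : ℕ → V), w 0 = u ∧ w (k + 1) = v ∧
      (∀ i, 1 ≤ i → i ≤ k → w i ∈ S) ∧
      (∀ i, i ≤ k → IsLocalPair G ε (w i) (w (i + 1))) ∧
      ∑ i ∈ Finset.range (k + 1), G.dist (w i) (w (i + 1)) = G.dist u v from
    fun u v h => H _ u v rfl h.1
  intro N
  induction N using Nat.strong_induction_on with
  | _ N ih =>
    intro u v hN hr
    by_cases hloc : G.dist u v < ⌈ε⌉₊
    · refine ⟨0, fun i => if i = 0 then u else v, by simp, by simp, fun i h1 h2 => by omega, ?_,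
        by simp⟩
      intro i hi
      obtain rfl : i = 0 := by omega
      exact ⟨by simpa using hr, by simpa using Nat.lt_ceil.1 hloc⟩
    · obtain ⟨x, hx, hxd⟩ := exists_between_dist_eq hr (not_lt.1 hloc)
      obtain ⟨s, hsS, hs, hpos, hlt⟩ := hS u x hx.1 hxd
      obtain ⟨hx1, hx2, hx3⟩ := hx
      obtain ⟨hs1, hs2, hs3⟩ := hs
      have t1 := hs2.dist_triangle_left v
      have t2 := hs1.dist_triangle_left v
      have hsv : G.dist u s + G.dist s v = G.dist u v := by omega
      obtain ⟨k, w, hw0, hwk, hwS, hwl, hws⟩ := ih (G.dist s v) (by omega) s v rfl (hs2.trans hx2)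
      refine ⟨k + 1, fun i => Nat.casesOn i u w, rfl, hwk, ?_, ?_, ?_⟩
      · rintro (_ | _ | i) h1 h2
        · omega
        · simpa [hw0] using hsS
        · exact hwS (i + 1) (by omega) (by omega)
      · rintro (_ | i) h
        · change IsLocalPair G ε u (w 0)
          exact hw0 ▸ ⟨hs1, Nat.lt_ceil.1 hlt⟩
        · exact hwl i (by omega)
      · rw [Finset.sum_range_succ']
        change ∑ i ∈ range (k + 1), G.dist (w i) (w (i + 1)) + G.dist u (w 0) = G.dist u v
        rw [hws, hw0]
        omega

/-! ### Hitting sets -/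

/-- Greedy hitting sets: among sets with at least `a` elements each, a suitable choice of `K` points
leaves at most a fraction `(1 - a / n) ^ K` of them unhit. -/
theorem exists_card_le_card_disjoint_le {V ι : Type*} [Fintype V] [DecidableEq V] (I : Finset ι)
    (F : ι → Finset V) (a : ℕ) (ha : a ≤ Fintype.card V) (hF : ∀ i ∈ I, a ≤ #(F i)) (K : ℕ) :
    ∃ S : Finset V, #S ≤ K ∧
      (#{i ∈ I | Disjoint S (F i)} : ℝ) ≤ #I * (1 - (a : ℝ) / Fintype.card V) ^ K := by
  rcases isEmpty_or_nonempty V with hV | hV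
  -- Here `a / 0 = 0`, so the bound is just `#I`.
  · refine ⟨∅, by simp, ?_⟩
    simp
  have hn : (0 : ℝ) < Fintype.card V := by exact_mod_cast Fintype.card_pos
  have hq : (0 : ℝ) ≤ 1 - (a : ℝ) / Fintype.card V := by
    rw [sub_nonneg, div_le_one hn]
    exact_mod_cast ha
  induction K with
  | zero => exact ⟨∅, by simp, by simp⟩
  | succ K ih =>
    obtain ⟨S, hSK, hS⟩ := ih
    set R := I.filter fun i => Disjoint S (F i) with hR
    have hcount : ∑ s : V, (#{i ∈ R | s ∈ F i} : ℝ) = ∑ i ∈ R, (#(F i) : ℝ) := by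
      have := Finset.sum_card_bipartiteAbove_eq_sum_card_bipartiteBelow
        (s := (univ : Finset V)) (t := R) (fun s i => s ∈ F i)
      simp only [Finset.bipartiteAbove, Finset.bipartiteBelow, Finset.filter_univ_mem] at this
      exact_mod_cast this
    have hlow : (#R : ℝ) * a ≤ ∑ i ∈ R, (#(F i) : ℝ) := by
      rw [← nsmul_eq_mul]
      exact Finset.card_nsmul_le_sum _ _ _ fun i hi => by
        exact_mod_cast hF i (Finset.mem_filter.1 hi).1
    -- Averaging: some vertex lies in at least a fraction `a / n` of the unhit sets.
    obtain ⟨s, -, hs⟩ : ∃ s ∈ (univ : Finset V),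
        (#R : ℝ) * a / Fintype.card V ≤ #{i ∈ R | s ∈ F i} := by
      apply Finset.exists_le_of_sum_le Finset.univ_nonempty
      rw [hcount, Finset.sum_const, Finset.card_univ, nsmul_eq_mul, mul_div_cancel₀ _ hn.ne']
      exact hlow
    refine ⟨insert s S, (Finset.card_insert_le _ _).trans (by omega), ?_⟩
    have hsub : I.filter (fun i => Disjoint (insert s S) (F i)) = R.filter fun i => s ∉ F i := by
      ext i
      simp only [hR, Finset.mem_filter, Finset.disjoint_insert_left]
      tauto
    have hsplit := Finset.card_filter_add_card_filter_not (s := R) (fun i => s ∈ F i)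
    have hsplit' : (#{i ∈ R | s ∈ F i} : ℝ) + #{i ∈ R | s ∉ F i} = #R := by exact_mod_cast hsplit
    rw [hsub]
    calc (#{i ∈ R | s ∉ F i} : ℝ) ≤ #R * (1 - (a : ℝ) / Fintype.card V) := by
          rw [mul_sub, mul_one, ← mul_div_assoc]
          linarith
      _ ≤ (#I * (1 - (a : ℝ) / Fintype.card V) ^ K) * (1 - (a : ℝ) / Fintype.card V) :=
          mul_le_mul_of_nonneg_right hS hq
      _ = _ := by ring

/-- Few initial segments: from a root `u`, at most `n / b` vertex sets of size `a` suffice so that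
each vertex at distance at least `a + b` has one of them on a shortest path from `u`. -/
theorem exists_initial_segments {V : Type*} [Fintype V] [DecidableEq V] (G : SimpleGraph V) (u : V)
    (a b : ℕ) :
    ∃ (A : Finset V) (F : V → Finset V), #A * b ≤ Fintype.card V ∧ (∀ x ∈ A, a ≤ #(F x)) ∧
      ∀ v, G.Reachable u v → a + b ≤ G.dist u v →
        ∃ x ∈ A, ∀ s ∈ F x, Between G u s v ∧ 0 < G.dist u s ∧ G.dist u s ≤ a := by
  classical
  obtain ⟨f, hf⟩ := exists_parent G u
  have hd : ∀ {x : V}, G.Reachable u x → ∀ {k : ℕ}, k ≤ G.dist u x →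
      G.dist u (f^[k] x) = G.dist u x - k := fun hx _ hk => (between_iterate_parent hf hx hk).2
  have hinj : ∀ {x : V}, G.Reachable u x → ∀ {c : ℕ}, c ≤ G.dist u x →
      #((range c).image fun j => f^[j] x) = c := by
    intro x hx c hc
    rw [Finset.card_image_of_injOn, Finset.card_range]
    intro i hi j hj hij
    rw [Finset.coe_range, Set.mem_Iio] at hi hj
    have h1 := hd hx (k := i) (by omega)
    have h2 := hd hx (k := j) (by omega)
    simp only at hij
    rw [hij] at h1
    omega
  -- `A` holds the depth-`a` ancestors of vertices at depth `a + b`; `F x` is the tree path from `x`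
  -- towards `u`, root excluded.
  refine ⟨(univ.filter fun v => G.Reachable u v ∧ G.dist u v = a + b).image fun v => f^[b] v,
    fun x => (range a).image fun j => f^[j] x, ?_, ?_, ?_⟩
  · set A := (univ.filter fun v => G.Reachable u v ∧ G.dist u v = a + b).image fun v => f^[b] v
    -- The fibres of "ancestor at depth `a`" are disjoint; the one over `x` contains the `b` path
    -- vertices at depths `a + 1, …, a + b`.
    calc #A * b ≤ ∑ x ∈ A, #{y : V | f^[G.dist u y - a] y = x} := by
          rw [← smul_eq_mul]
          refine Finset.card_nsmul_le_sum _ _ _ fun x hx => ?_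
          obtain ⟨v, hv, rfl⟩ := Finset.mem_image.1 hx
          obtain ⟨-, hr, hv⟩ := Finset.mem_filter.1 hv
          rw [← hinj hr (c := b) (by omega)]
          refine Finset.card_le_card fun y hy => ?_
          obtain ⟨j, hj, rfl⟩ := Finset.mem_image.1 hy
          rw [Finset.mem_range] at hj
          rw [Finset.mem_filter]
          refine ⟨Finset.mem_univ _, ?_⟩
          rw [hd hr (by omega), ← Function.iterate_add_apply, hinj hr (by omega)]
          congr 1
          omega
      _ = #{y : V | f^[G.dist u y - a] y ∈ A} :=
          Finset.sum_card_fiberwise_eq_card_filter _ _ _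
      _ ≤ Fintype.card V := Finset.card_le_univ _
  · intro x hx
    obtain ⟨v, hv, rfl⟩ := Finset.mem_image.1 hx
    obtain ⟨-, hr, hv⟩ := Finset.mem_filter.1 hv
    have hb := between_iterate_parent hf hr (k := b) (by omega)
    exact (hinj hb.1.1 (by omega)).ge
  · intro v hr hv
    have hb := between_iterate_parent hf hr (k := G.dist u v - (a + b)) (by omega)
    refine ⟨f^[b] (f^[G.dist u v - (a + b)] v), Finset.mem_image_of_mem _ ?_, ?_⟩
    · exact Finset.mem_filter.2 ⟨Finset.mem_univ _, hb.1.1, by omega⟩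
    · intro s hs
      obtain ⟨j, hj, rfl⟩ := Finset.mem_image.1 hs
      rw [Finset.mem_range] at hj
      rw [← Function.iterate_add_apply, ← Function.iterate_add_apply]
      have h := between_iterate_parent hf hr (k := j + b + (G.dist u v - (a + b))) (by omega)
      exact ⟨h.1, by omega, by omega⟩

/-- If `K` greedy steps leave fewer than `a` initial segments unhit, where `3 * a ≤ m + 1`, then `K`
vertices meet the interior of every interval of length `m`. -/
theorem exists_hitting_set {V : Type*} [Fintype V] (G : SimpleGraph V) {m a K : ℕ}
    (ha : 1 ≤ a) (ham : 3 * a ≤ m + 1) (han : a ≤ Fintype.card V)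
    (hK : ((Fintype.card V : ℝ) / a) ^ 2 * (1 - (a : ℝ) / Fintype.card V) ^ K < 1) :
    ∃ S : Finset V, #S ≤ K ∧ ∀ u v, G.Reachable u v → G.dist u v = m →
      ∃ s ∈ S, Between G u s v ∧ 0 < G.dist u s ∧ G.dist u s < m := by
  classical
  choose A F hA hF hAF using fun u => exists_initial_segments G u a a
  obtain ⟨S, hSK, hS⟩ := exists_card_le_card_disjoint_le
    (univ.sigma A : Finset (Σ _ : V, V)) (fun i => F i.1 i.2) a han
    (fun i hi => hF _ _ (Finset.mem_sigma.1 hi).2) K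
  refine ⟨S, hSK, fun u v hr hm => ?_⟩
  by_contra! hcon
  have ha0 : (0 : ℝ) < a := by exact_mod_cast ha
  have hn0 : (0 : ℝ) < Fintype.card V := by exact_mod_cast (show 0 < Fintype.card V by omega)
  have hfew : (#{i ∈ (univ.sigma A : Finset (Σ _ : V, V)) | Disjoint S (F i.1 i.2)} : ℝ) < a := by
    have hcard : (#(univ.sigma A : Finset (Σ _ : V, V)) : ℝ) * a ≤ (Fintype.card V : ℝ) ^ 2 := by
      have h : #(univ.sigma A : Finset (Σ _ : V, V)) * a ≤ Fintype.card V ^ 2 := by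
        rw [Finset.card_sigma, Finset.sum_mul, sq]
        exact (Finset.sum_le_card_nsmul _ _ _ fun u _ => hA u).trans (by simp)
      exact_mod_cast h
    have hq : (0 : ℝ) ≤ (1 - (a : ℝ) / Fintype.card V) ^ K := by
      refine pow_nonneg ?_ _
      rw [sub_nonneg, div_le_one hn0]
      exact_mod_cast han
    calc _ ≤ _ := hS
      _ ≤ ((Fintype.card V : ℝ) ^ 2 / a) * (1 - (a : ℝ) / Fintype.card V) ^ K :=
          mul_le_mul_of_nonneg_right ((le_div_iff₀ ha0).2 hcard) hq
      _ = a * (((Fintype.card V : ℝ) / a) ^ 2 * (1 - (a : ℝ) / Fintype.card V) ^ K) := by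
          field_simp
      _ < a * 1 := mul_lt_mul_of_pos_left hK ha0
      _ = a := mul_one _
  have hmany : a ≤ #{i ∈ (univ.sigma A : Finset (Σ _ : V, V)) | Disjoint S (F i.1 i.2)} := by
    have hex : ∀ i : Fin a, ∃ p : Σ _ : V, V,
        (p ∈ (univ.sigma A : Finset (Σ _ : V, V)) ∧ Disjoint S (F p.1 p.2)) ∧
          G.dist u p.1 = i := by
      intro i
      -- As `i ≤ a - 1`, the vertex `x` is at distance at least `m + 1 - a ≥ 2 * a` from `v`.
      obtain ⟨x, hx, hxi⟩ := exists_between_dist_eq hr (i := i) (by omega)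
      obtain ⟨y, hy, hyF⟩ := hAF x v hx.2.1 (by have := hx.2.2; omega)
      refine ⟨⟨x, y⟩, ⟨by simpa using hy, ?_⟩, hxi⟩
      rw [Finset.disjoint_left]
      intro s hsS hsF
      obtain ⟨hs1, hs2, hs3⟩ := hyF s hsF
      obtain ⟨h1, h2⟩ := hx.trans_right hs1
      -- `s ≠ u` since `s` is beyond `x`, and `d(u, s) ≤ (a - 1) + a < m`.
      have h3 := hcon s hsS h1 (by omega)
      have h4 := hx.1.dist_triangle_left s
      have := i.2
      omega
    choose p hp hpd using hex
    have hinj : Function.Injective p := fun i j hij => by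
      have h1 := hpd i
      rw [hij, hpd j] at h1
      exact Fin.ext h1.symm
    calc a = #((univ : Finset (Fin a)).image p) := by
          rw [Finset.card_image_of_injective _ hinj, Finset.card_univ, Fintype.card_fin]
      _ ≤ _ := Finset.card_le_card fun q hq => by
          obtain ⟨i, -, rfl⟩ := Finset.mem_image.1 hq
          exact Finset.mem_filter.2 (hp i)
  have : (a : ℝ) ≤ _ := Nat.cast_le.2 hmany
  linarith

/-! ### Numerical estimates and the final bound -/

/-- The number of greedy steps needed for a density `1 / t`. -/
theorem sq_mul_one_sub_inv_pow_lt_one {t : ℝ} (ht : 1 ≤ t) {K : ℕ}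
    (hK : 2 * (t * Real.log t) < K) : t ^ 2 * (1 - t⁻¹) ^ K < 1 := by
  have ht0 : 0 < t := by linarith
  have hq : 0 ≤ 1 - t⁻¹ := sub_nonneg.2 (inv_le_one_of_one_le₀ ht)
  have h1 : (1 - t⁻¹) ^ K ≤ Real.exp (-(K * t⁻¹)) := by
    calc (1 - t⁻¹) ^ K ≤ Real.exp (-t⁻¹) ^ K := by
          gcongr
          have := Real.add_one_le_exp (-t⁻¹)
          linarith
      _ = _ := by rw [← Real.exp_nat_mul]; ring_nf
  have h2 : t ^ 2 = Real.exp (2 * Real.log t) := by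
    rw [mul_comm, Real.exp_mul, Real.exp_log ht0]
    norm_cast
  have h3 : 2 * Real.log t < K * t⁻¹ := by
    rw [← div_eq_mul_inv, lt_div_iff₀ ht0]
    linarith
  calc t ^ 2 * (1 - t⁻¹) ^ K ≤ Real.exp (2 * Real.log t) * Real.exp (-(K * t⁻¹)) := by
        rw [h2]; gcongr
    _ = Real.exp (2 * Real.log t - K * t⁻¹) := by rw [← Real.exp_add]; ring_nf
    _ < 1 := Real.exp_lt_one_iff.2 (by linarith)

/-- The logarithmic bound in terms of `r = n / (ε - 1)`. -/
theorem two_mul_log_add_one_le {t r : ℝ} (ht : 1 ≤ t) (hr : 1 ≤ r) (htr : t ≤ 3 * r) :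
    2 * (t * Real.log t) + 1 ≤ 20 * (r * Real.log (max 2 r)) := by
  set L := Real.log (max 2 r)
  have hl2 : (1 / 2 : ℝ) ≤ Real.log 2 := by have := Real.log_two_gt_d9; linarith
  have hL2 : Real.log 2 ≤ L := Real.log_le_log (by norm_num) (le_max_left _ _)
  have hLr : Real.log r ≤ L := Real.log_le_log (by linarith) (le_max_right _ _)
  have hlog : Real.log t ≤ 3 * L := by
    calc Real.log t ≤ Real.log (2 ^ 2 * r) := Real.log_le_log (by linarith) (by linarith)
      _ = 2 * Real.log 2 + Real.log r := by
          rw [Real.log_mul (by norm_num) (by linarith), Real.log_pow]; norm_num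
      _ ≤ 3 * L := by linarith
  have h1 : t * Real.log t ≤ (3 * r) * (3 * L) :=
    mul_le_mul htr hlog (Real.log_nonneg ht) (by linarith)
  -- This absorbs the `+ 1` into `2 * (r * L)`; with `2 * 9` from `h1` the constant is `20`.
  have h2 : 1 * (1 / 2) ≤ r * L := mul_le_mul hr (by linarith) (by norm_num) (by linarith)
  linarith

/-- A small gate-vertex set exists. -/
theorem exists_isGateVertexSet_card_le {V : Type*} [Fintype V] (G : SimpleGraph V) {ε : ℝ}
    (hε : 1 < ε) :
    ∃ S : Finset V, IsGateVertexSet G ε S ∧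
      (#S : ℝ) ≤ 20 * (((Fintype.card V : ℝ) / (ε - 1)) *
        Real.log (max 2 ((Fintype.card V : ℝ) / (ε - 1)))) := by
  have hε0 : 0 < ε - 1 := by linarith
  -- A pair at distance `⌈ε⌉₊` forces `⌈ε⌉₊ < n`, hence `n / (ε - 1) ≥ 1`; without one, no gates are
  -- needed.
  by_cases hex : ∃ u v, G.Reachable u v ∧ G.dist u v = ⌈ε⌉₊
  · obtain ⟨u, v, hr, huv⟩ := hex
    set m := ⌈ε⌉₊
    have hεm : ε ≤ m := Nat.le_ceil ε
    have hm : 2 ≤ m := Nat.lt_ceil.2 (by simpa using hε)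
    have hmn : m < Fintype.card V := by
      obtain ⟨p, hp, hpl⟩ := hr.exists_path_of_dist
      have := hp.length_lt
      omega
    -- The largest `a` with `3 * a ≤ m + 1`; rounding still gives `ε - 1 ≤ 3 * a`, hence `t ≤ 3 * r`
    -- with `r = n / (ε - 1)`.
    set a := (m + 1) / 3
    have ha : 1 ≤ a := by omega
    have ham : 3 * a ≤ m + 1 := by omega
    have hma : m ≤ 3 * a + 1 := by omega
    have ha0 : (0 : ℝ) < a := by exact_mod_cast ha
    have hma' : (m : ℝ) ≤ 3 * a + 1 := by exact_mod_cast hma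
    have han : a ≤ Fintype.card V := by omega
    have han' : (a : ℝ) ≤ Fintype.card V := by exact_mod_cast han
    have hmn' : (m : ℝ) < Fintype.card V := by exact_mod_cast hmn
    set t : ℝ := (Fintype.card V : ℝ) / a with ht
    have ht1 : 1 ≤ t := (one_le_div ha0).2 han'
    have hinv : (a : ℝ) / Fintype.card V = t⁻¹ := by rw [ht, inv_div]
    set K := ⌊2 * (t * Real.log t)⌋₊ + 1 with hKdef
    have hK : 2 * (t * Real.log t) < K := by
      rw [hKdef]
      exact_mod_cast Nat.lt_floor_add_one (2 * (t * Real.log t))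
    obtain ⟨S, hSK, hS⟩ := exists_hitting_set G ha ham han (K := K) (by
      rw [hinv]
      exact sq_mul_one_sub_inv_pow_lt_one ht1 hK)
    refine ⟨S, isGateVertexSet_of_forall_dist_eq_ceil hS, ?_⟩
    have hlt : 0 ≤ 2 * (t * Real.log t) :=
      mul_nonneg zero_le_two (mul_nonneg (by linarith) (Real.log_nonneg ht1))
    calc (#S : ℝ) ≤ K := by exact_mod_cast hSK
      _ ≤ 2 * (t * Real.log t) + 1 := by
          rw [hKdef]
          push_cast
          have := Nat.floor_le hlt
          linarith
      _ ≤ _ := by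
          refine two_mul_log_add_one_le ht1 ((one_le_div hε0).2 (by linarith)) ?_
          rw [ht, ← mul_div_assoc, div_le_div_iff₀ ha0 hε0]
          have : ε - 1 ≤ 3 * a := by linarith
          nlinarith
  · refine ⟨∅, isGateVertexSet_of_forall_dist_eq_ceil fun u v hr hd =>
      absurd ⟨u, v, hr, hd⟩ hex, ?_⟩
    have : 0 ≤ Real.log (max 2 ((Fintype.card V : ℝ) / (ε - 1))) :=
      Real.log_nonneg (le_max_of_le_left (by norm_num))
    simp only [Finset.card_empty, Nat.cast_zero]
    positivity

end GateVertex

theorem mainTheorem2 :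
    ∃ C : ℝ, 0 < C ∧
      ∀ (V : Type*) [Fintype V] (G : SimpleGraph V) (ε : ℝ), 1 < ε →
        (∃ S : Finset V, GateVertex.IsMinimumGateVertexSet G ε S) ∧
        ∀ S : Finset V, GateVertex.IsMinimumGateVertexSet G ε S →
          (S.card : ℝ) ≤ C * (((Fintype.card V : ℝ) / (ε - 1)) *
            Real.log (max 2 ((Fintype.card V : ℝ) / (ε - 1)))) := by
  refine ⟨20, by norm_num, fun V _ G ε hε => ?_⟩
  obtain ⟨T, hT, hTcard⟩ := GateVertex.exists_isGateVertexSet_card_le G hε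
  refine ⟨?_, fun S hS => ?_⟩
  · obtain ⟨S, hS, hmin⟩ := exists_minimalFor_of_wellFoundedLT
      (GateVertex.IsGateVertexSet G ε) Finset.card ⟨T, hT⟩
    exact ⟨S, hS, fun U hU => (le_total S.card U.card).elim id (hmin hU)⟩
  · exact (Nat.cast_le.2 (hS.2 T hT)).trans hTcard
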